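/- Let $\mathcal F_S$ and $\mathcal Y$ be finite-dimensional real vector spaces with duals $\mathcal E_S=\mathcal F_S^*$ and $\mathcal U=\mathcal Y^*$. A relation $\mathcal R\subset\mathcal F\times\mathcal F^*$ is monotone if $\langle e_1-e_2\mid f_1-f_2\rangle\ge 0$ for all $(f_1,e_1),(f_2,e_2)\in\mathcal R$; it is cyclically monotone if $\sum_{i=0}^{m}\langle e_i\mid f_i-f_{i+1}\rangle\ge 0$ (with $f_{m+1}:=f_0$) for all $m\ge1$ and all $(f_0,e_0),\dots,(f_m,e_m)\in\mathcal R$; it is maximal monotone if it is monotone and not properly contained in another monotone relation. Write $\operatorname{rint}S$ for the relative interior of $\operatorname{cl}S$ (for convex $S$ this is the usual relative interior). Let $\mathcal M\subset\mathcal F_S\times\mathcal E_S\times\mathcal Y\times\mathcal U$ be the maximal monotone relation underlying a maximal monotone port-Hamiltonian system; here the flow is $(f_S,y)$, the effort is $(e_S,u)$, and the pairing is $\langle e_S\mid f_S\rangle+\langle u\mid y\rangle$. Assume that $$0\in\operatorname{rint}\{f_S \mid \exists\, e_S,y,u:\ (f_S,e_S,y,u)\in\mathcal M\}$$ and that there exists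 $$\bar e\in\operatorname{rint}\{e_S \mid \exists\, y,u:\ (0,e_S,y,u)\in\mathcal M\}.$$ Then $$\mathcal M_s=\{(y,u)\mid \exists\, e_S \text{ such that } (0,e_S,y,u)\in\mathcal M\}$$ is a maximal monotone relation in $\mathcal Y\times\mathcal U$. Suppose furthermore that $\mathcal M$ is cyclically monotone. Then $\mathcal M$ is the graph of the subdifferential of some proper lower semicontinuous convex function $K:\mathcal E_S\times\mathcal U\to(-\infty,+\infty]$, i.e. $(f_S,e_S,y,u)\in\mathcal M$ if and only if $(f_S,y)\in\partial K(e_S,u)$. Moreover, for every proper convex function $K:\mathcal E_S\times\mathcal U\to(-\infty,+\infty]$ with this property, the function $$K_s(u):=-K^*(0,u)=\inf_{e_S}K(e_S,u),\qquad K^*(f_S,u):=\sup_{e_S}\big(\langle e_S\mid f_S\rangle-K(e_S,u)\big),$$ where $K^*$ is the partial convex conjugate of $K$ with respect to $e_S$, is a proper convex function $\mathcal U\to(-\infty,+\infty]$, and $\mathcal M_s$ is the graph of $\partial K_s$: $(y,u)\in\mathcal M_s$ if and only if $y\in\partial K_s(u)$. -/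

import Mathlib

namespace IncPH

section Relations

variable {F : Type*} [NormedAddCommGroup F] [NormedSpace ℝ F]

/-- Monotonicity of a relation `M ⊆ F × F*`. -/
def IsMonotone (M : Set (F × StrongDual ℝ F)) : Prop :=
  ∀ p ∈ M, ∀ q ∈ M, 0 ≤ (p.2 - q.2) (p.1 - q.1)

/-- Maximal monotonicity of a relation `M ⊆ F × F*`. -/
def IsMaximalMonotone (M : Set (F × StrongDual ℝ F)) : Prop :=
  IsMonotone M ∧ ∀ M' : Set (F × StrongDual ℝ F), IsMonotone M' → M ⊆ M' → M = M'

/-- Cyclic monotonicity of a relation `M ⊆ F × F*`. The addition `i + 1` in `Fin (m + 1)` is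
cyclic, so the successor of the last index `m` is `0`. -/
def IsCyclicallyMonotone (M : Set (F × StrongDual ℝ F)) : Prop :=
  ∀ m : ℕ, 1 ≤ m → ∀ z : Fin (m + 1) → F × StrongDual ℝ F, (∀ i, z i ∈ M) →
    0 ≤ ∑ i, (z i).2 ((z i).1 - (z (i + 1)).1)

/-- The graph, as a set of (flow, effort) pairs, of the subdifferential of an extended-real
function `φ` of the effort variables: the pairs `(f, e)` with `e ∈ dom φ` and `f ∈ ∂φ(e)`, where
a flow `f` is viewed as the functional `e ↦ e f` on `F*`. -/
def subdiffGraph (φ : StrongDual ℝ F → EReal) : Set (F × StrongDual ℝ F) :=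
  {p | φ p.2 < ⊤ ∧ ∀ e' : StrongDual ℝ F, φ p.2 + (((e' - p.2) p.1 : ℝ) : EReal) ≤ φ e'}

end Relations

/-- A proper convex function with values in `(-∞, +∞]`: it never takes the value `-∞`, it is not
identically `+∞`, and its epigraph is convex. -/
def IsProperConvex {V : Type*} [AddCommGroup V] [Module ℝ V] (φ : V → EReal) : Prop :=
  (∀ v, φ v ≠ ⊥) ∧ (∃ v, φ v ≠ ⊤) ∧ Convex ℝ {p : V × ℝ | φ p.1 ≤ (p.2 : EReal)}

/-- The relative interior `rint S = rint (cl S)`. For a convex set this is the usual relative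
interior; for a nearly convex set (`C ⊆ S ⊆ cl C` with `C` convex) it is that of `C`. -/
def rint {V : Type*} [NormedAddCommGroup V] [NormedSpace ℝ V] (S : Set V) : Set V :=
  intrinsicInterior ℝ (closure S)

section SteadyState

variable {FS Y : Type*} [NormedAddCommGroup FS] [NormedSpace ℝ FS]
  [NormedAddCommGroup Y] [NormedSpace ℝ Y]

/-! The flow space is `FS × Y`. Its dual is identified with `FS* × Y*`, the pair `(eS, u)` being
the functional `eS.coprod u : (fS, y) ↦ eS fS + u y`. So `(fS, eS, y, u) ∈ M` reads
`((fS, y), eS.coprod u) ∈ M`. -/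

/-- The projection of `M` on the space `FS` of state flows. -/
def stateFlows (M : Set ((FS × Y) × StrongDual ℝ (FS × Y))) : Set FS :=
  {fS | ∃ (eS : StrongDual ℝ FS) (y : Y) (u : StrongDual ℝ Y), ((fS, y), eS.coprod u) ∈ M}

/-- The set of state efforts `eS` such that `(0, eS)` is in the projection of `M` on
`FS × FS*`. -/
def zeroFlowEfforts (M : Set ((FS × Y) × StrongDual ℝ (FS × Y))) : Set (StrongDual ℝ FS) :=
  {eS | ∃ (y : Y) (u : StrongDual ℝ Y), (((0 : FS), y), eS.coprod u) ∈ M}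

/-- The relation `{(y, u) | ∃ eS, (0, eS, y, u) ∈ M}`. -/
def steadyState (M : Set ((FS × Y) × StrongDual ℝ (FS × Y))) : Set (Y × StrongDual ℝ Y) :=
  {p | ∃ eS : StrongDual ℝ FS, (((0 : FS), p.1), eS.coprod p.2) ∈ M}

/-- The partial convex conjugate of `K(eS, u)` with respect to `eS`:
`K*(fS, u) = sup_{eS} (⟨eS, fS⟩ - K(eS, u))`. -/
noncomputable def partialConjugate (K : StrongDual ℝ (FS × Y) → EReal)
    (fS : FS) (u : StrongDual ℝ Y) : EReal :=
  ⨆ eS : StrongDual ℝ FS, ((eS fS : ℝ) : EReal) - K (eS.coprod u)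

/-- The function `K_s(u) = -K*(0, u)`, that is, `K_s(u) = inf_{eS} K(eS, u)`. -/
noncomputable def steadyStateFunction (K : StrongDual ℝ (FS × Y) → EReal)
    (u : StrongDual ℝ Y) : EReal :=
  -partialConjugate K 0 u

end SteadyState

end IncPH

/-! In finite dimension maximality of a monotone relation is equivalent to Minty's condition: for a
symmetric positive definite form `B`, every `w` admits `x` with `(x, w - B x)` in the relation. To
verify it for the steady states, the constraint `fS = 0` is relaxed to `eS = -A (n • fS)`, and
Minty's theorem for `M` solves each relaxed problem. Monotonicity against a point of `M` with state
flow `g` bounds `‖y n‖ ^ 2` by a constant plus a multiple of `A (n • f n) g`. Since `0` is a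
relative interior point of the state flows, these one-sided bounds make `n • f n`, and then `y n`,
bounded. Along a subsequence `f n → 0`, and the limit lies in the closed set `M`.

In the cyclic case Rockafellar's potential gives `K`. Subgradient inequalities with flow `(0, y)`
survive the infimum over `eS`, so the steady states lie in the graph of `∂K_s`; that graph is
monotone, and maximality forces equality. -/

namespace IncPH

/-! ### Minty's theorem in finite dimension -/

section Minty

variable {F : Type*} [NormedAddCommGroup F] [NormedSpace ℝ F]

/-- The form plays the role of the duality map, as the given norm need not be Euclidean. -/
theorem exists_coercive_form (F : Type*) [NormedAddCommGroup F] [NormedSpace ℝ F]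
    [FiniteDimensional ℝ F] :
    ∃ B : F →L[ℝ] StrongDual ℝ F, (∀ x y, B x y = B y x) ∧
      ∃ c : ℝ, 0 < c ∧ ∀ x, c * ‖x‖ ^ 2 ≤ B x x := by
  let L : F ≃L[ℝ] EuclideanSpace ℝ (Fin (Module.finrank ℝ F)) := toEuclidean
  let B : F →L[ℝ] StrongDual ℝ F :=
    (innerSL ℝ).bilinearComp (L : F →L[ℝ] EuclideanSpace ℝ (Fin (Module.finrank ℝ F)))
      (L : F →L[ℝ] EuclideanSpace ℝ (Fin (Module.finrank ℝ F)))
  have hB : ∀ x y, B x y = inner ℝ (L x) (L y) := fun x y => rfl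
  refine ⟨B, fun x y => by rw [hB, hB, real_inner_comm], ?_⟩
  -- The `+ 1` keeps `C` positive even on the zero space.
  set C : ℝ := ‖(L.symm : EuclideanSpace ℝ (Fin (Module.finrank ℝ F)) →L[ℝ] F)‖ + 1
  have hC : 0 < C := by positivity
  refine ⟨1 / C ^ 2, by positivity, fun x => ?_⟩
  have h1 : ‖x‖ ≤ C * ‖L x‖ := by
    have h := (L.symm : EuclideanSpace ℝ (Fin (Module.finrank ℝ F)) →L[ℝ] F).le_opNorm (L x)
    simp only [ContinuousLinearEquiv.coe_coe, ContinuousLinearEquiv.symm_apply_apply] at h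
    refine h.trans (mul_le_mul_of_nonneg_right ?_ (norm_nonneg _))
    simp [C]
  rw [hB, real_inner_self_eq_norm_sq, one_div, inv_mul_le_iff₀ (by positivity), ← mul_pow]
  exact pow_le_pow_left₀ (norm_nonneg _) h1 2

theorem sum_mul_form_sub_sub {ι : Type*} [Fintype ι] (B : F →L[ℝ] StrongDual ℝ F) {μ : ι → ℝ}
    (hμ : ∑ i, μ i = 1) (a p : ι → F) (c d : F) :
    ∑ i, μ i * B (a i - c) (p i - d) =
      ∑ i, μ i * B (a i) (p i) - B (∑ i, μ i • a i) d - B c (∑ i, μ i • p i) + B c d := by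
  have h1 : B (∑ i, μ i • a i) d = ∑ i, μ i * B (a i) d := by
    simp [map_sum]
  have h2 : B c (∑ i, μ i • p i) = ∑ i, μ i * B c (p i) := by simp [map_sum]
  have h3 : B c d = ∑ i, μ i * B c d := by rw [← Finset.sum_mul, hμ, one_mul]
  rw [h1, h2, h3, ← Finset.sum_sub_distrib, ← Finset.sum_sub_distrib, ← Finset.sum_add_distrib]
  refine Finset.sum_congr rfl fun i _ => ?_
  simp only [map_sub, sub_apply]
  ring

/-- Convex combinations of the functions `x ↦ B (x + a i) (x - p i)` take a nonpositive value. -/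
theorem exists_sum_mul_form_nonpos {ι : Type*} [Fintype ι] (B : F →L[ℝ] StrongDual ℝ F)
    (hsymm : ∀ x y, B x y = B y x) (hpos : ∀ x, 0 ≤ B x x) {μ : ι → ℝ} (hμ0 : ∀ i, 0 ≤ μ i)
    (hμ : ∑ i, μ i = 1) (a p : ι → F) (hmono : ∀ i j, 0 ≤ B (a i - a j) (p i - p j)) :
    ∃ x, ∑ i, μ i * B (x + a i) (x - p i) ≤ 0 := by
  set A := ∑ i, μ i • a i with hA
  set P := ∑ i, μ i • p i with hP
  set S := ∑ i, μ i * B (a i) (p i) with hS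
  -- Averaging `hmono` over all pairs `(i, j)`: the covariance of `a` and `p` under `μ` is
  -- nonnegative.
  have h1 : 0 ≤ 2 * S - 2 * B A P := by
    have h : 0 ≤ ∑ j, μ j * ∑ i, μ i * B (a i - a j) (p i - p j) :=
      Finset.sum_nonneg fun j _ => mul_nonneg (hμ0 j) <|
        Finset.sum_nonneg fun i _ => mul_nonneg (hμ0 i) (hmono i j)
    have h' : ∑ j, μ j * ∑ i, μ i * B (a i - a j) (p i - p j)
        = ∑ j, μ j * B (a j - A) (p j - P) + S - B A P := by
      have hc : S - B A P = ∑ j, μ j * (S - B A P) := by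
        rw [← Finset.sum_mul, hμ, one_mul]
      rw [add_sub_assoc, hc, ← Finset.sum_add_distrib]
      refine Finset.sum_congr rfl fun j _ => ?_
      rw [sum_mul_form_sub_sub B hμ]
      simp only [map_sub, sub_apply, ← hA, ← hP, ← hS]
      ring
    rw [h', sum_mul_form_sub_sub B hμ, ← hA, ← hP, ← hS] at h
    linarith
  -- At this point the average is `-B (P + A) (P + A) / 4` minus the covariance `S - B A P`.
  refine ⟨(1 / 2 : ℝ) • (P - A), ?_⟩
  set x := (1 / 2 : ℝ) • (P - A) with hx
  have h2 : ∑ i, μ i * B (x + a i) (x - p i) = -∑ i, μ i * B (a i - -x) (p i - x) := by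
    rw [← Finset.sum_neg_distrib]
    refine Finset.sum_congr rfl fun i _ => ?_
    rw [sub_neg_eq_add, add_comm x, ← neg_sub (p i) x, map_neg]
    ring
  have h3 := hpos (P + A)
  rw [h2, sum_mul_form_sub_sub B hμ, ← hA, ← hP, ← hS]
  simp only [hx, map_sub, map_add, map_neg, map_smul, sub_apply,
    add_apply, neg_apply, smul_apply,
    smul_eq_mul] at h3 ⊢
  rw [hsymm P A] at *
  linarith

theorem convexOn_form_add_sub (B : F →L[ℝ] StrongDual ℝ F) (hpos : ∀ x, 0 ≤ B x x) (a p : F) :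
    ConvexOn ℝ Set.univ fun x => B (x + a) (x - p) := by
  refine ⟨convex_univ, fun x _ y _ s t hs ht hst => ?_⟩
  have h := mul_nonneg (mul_nonneg hs ht) (hpos (x - y))
  obtain rfl : t = 1 - s := by linarith
  simp only [map_sub, map_add, map_smul, sub_apply,
    add_apply, smul_apply, smul_eq_mul] at h ⊢
  nlinarith [h]

/-- A minimax argument: if no `x` works, separating `ε` from the open convex set of strict upper
bounds gives multipliers whose average is positive for every `x`, against
`exists_sum_mul_form_nonpos`. -/
theorem exists_forall_form_lt {ι : Type*} [Fintype ι] (B : F →L[ℝ] StrongDual ℝ F)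
    (hsymm : ∀ x y, B x y = B y x) (hpos : ∀ x, 0 ≤ B x x) (a p : ι → F)
    (hmono : ∀ i j, 0 ≤ B (a i - a j) (p i - p j)) (ε : ι → ℝ) (hε : ∀ i, 0 < ε i) :
    ∃ x, ∀ i, B (x + a i) (x - p i) < ε i := by
  classical
  let q : ι → F → ℝ := fun i x => B (x + a i) (x - p i)
  let S : Set (ι → ℝ) := {t | ∃ x, ∀ i, q i x < t i}
  by_contra hne
  have hεS : ε ∉ S := hne
  have hopen : IsOpen S := by
    have : S = ⋃ x, Set.univ.pi fun i => Set.Ioi (q i x) := by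
      ext t
      simp [S]
    rw [this]
    exact isOpen_iUnion fun x => isOpen_set_pi Set.finite_univ fun i _ => isOpen_Ioi
  have hconv : Convex ℝ S := by
    rintro t₁ ⟨x₁, h₁⟩ t₂ ⟨x₂, h₂⟩ r s hr hs hrs
    refine ⟨r • x₁ + s • x₂, fun i => ?_⟩
    have h := (convexOn_form_add_sub B hpos (a i) (p i)).2 (Set.mem_univ x₁) (Set.mem_univ x₂)
      hr hs hrs
    refine lt_of_le_of_lt h ?_
    simp only [Pi.add_apply, Pi.smul_apply, smul_eq_mul]
    have e₁ := h₁ i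
    have e₂ := h₂ i
    simp only [q] at e₁ e₂
    rcases hr.eq_or_lt with rfl | hr'
    · obtain rfl : s = 1 := by linarith
      linarith
    · nlinarith [mul_lt_mul_of_pos_left e₁ hr', mul_le_mul_of_nonneg_left e₂.le hs]
  obtain ⟨f, hf⟩ := geometric_hahn_banach_open_point hconv hopen hεS
  have hfsum : ∀ t : ι → ℝ, f t = ∑ i, t i * f (Pi.single i 1) := fun t => by
    conv_lhs => rw [pi_eq_sum_univ' t, map_sum]
    simp only [map_smul, smul_eq_mul]
  have hS : ∀ x, (fun i => q i x + ε i) ∈ S := fun x => ⟨x, fun i => by linarith [hε i]⟩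
  have hneg : ∀ i, f (Pi.single i 1) ≤ 0 := by
    intro i
    by_contra! hi
    -- `S` is upward closed. A positive `i`-th coefficient would let a move along coordinate `i`
    -- raise `f` to exactly `f ε`, which strict separation forbids.
    set D := f ε - f (fun i => q i 0 + ε i) with hD
    have hDpos : 0 < D := sub_pos.2 (hf _ (hS 0))
    have hmem : (fun i => q i 0 + ε i) + (D / f (Pi.single i 1)) • Pi.single i (1 : ℝ) ∈ S := by
      refine ⟨0, fun j => ?_⟩
      have : 0 ≤ (D / f (Pi.single i 1)) * (Pi.single i (1 : ℝ) : ι → ℝ) j := by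
        refine mul_nonneg (div_pos hDpos hi).le ?_
        rw [Pi.single_apply]
        split_ifs <;> norm_num
      simp only [Pi.add_apply, Pi.smul_apply, smul_eq_mul]
      linarith [hε j]
    have h := hf _ hmem
    rw [map_add, map_smul, smul_eq_mul, div_mul_cancel₀ _ hi.ne'] at h
    linarith
  set Λ := ∑ i, -f (Pi.single i 1) with hΛ
  have hgt : ∀ x, 0 < ∑ i, -f (Pi.single i 1) * q i x := by
    intro x
    have h := hf _ (hS x)
    have e : f (fun i => q i x + ε i) = f (fun i => q i x) + f ε := by
      rw [← map_add]; rfl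
    rw [e, hfsum fun i => q i x] at h
    have : ∑ i, -f (Pi.single i 1) * q i x = -∑ i, q i x * f (Pi.single i 1) := by
      rw [← Finset.sum_neg_distrib]
      exact Finset.sum_congr rfl fun i _ => by ring
    linarith
  have hΛpos : 0 < Λ := by
    refine lt_of_le_of_ne (Finset.sum_nonneg fun i _ => neg_nonneg.2 (hneg i)) fun h0 => ?_
    have h := (Finset.sum_eq_zero_iff_of_nonneg fun i _ => neg_nonneg.2 (hneg i)).1 h0.symm
    have h' := hgt 0
    rw [Finset.sum_eq_zero fun i hi => by rw [h i hi, zero_mul]] at h'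
    exact h'.false
  obtain ⟨x, hx⟩ := exists_sum_mul_form_nonpos B hsymm hpos
    (μ := fun i => -f (Pi.single i 1) / Λ)
    (fun i => div_nonneg (neg_nonneg.2 (hneg i)) hΛpos.le)
    (by rw [← Finset.sum_div, ← hΛ, div_self hΛpos.ne']) a p hmono
  have h := div_pos (hgt x) hΛpos
  rw [Finset.sum_div] at h
  refine absurd hx (not_le.2 (h.trans_eq (Finset.sum_congr rfl fun i _ => ?_)))
  simp only [q]
  ring

theorem isCompact_form_le [FiniteDimensional ℝ F] (B : F →L[ℝ] StrongDual ℝ F) {c : ℝ}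
    (hc : 0 < c) (hB : ∀ x, c * ‖x‖ ^ 2 ≤ B x x) (a p : F) (r : ℝ) :
    IsCompact {x | B (x + a) (x - p) ≤ r} := by
  have : ProperSpace F := FiniteDimensional.proper ℝ F
  refine Metric.isCompact_of_isClosed_isBounded
    (isClosed_le (by fun_prop) continuous_const) ?_
  set k := ‖B a‖ + ‖B.flip p‖ with hk
  -- The summand `c` forces `1 ≤ ‖x‖` outside the ball, so the constant term is at most its multiple
  -- by `‖x‖` and the quadratic term wins.
  set R := (k + |r + B a p| + c) / c with hR
  refine (Metric.isBounded_closedBall (x := (0 : F)) (r := R)).subset fun x hx => ?_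
  rw [mem_closedBall_zero_iff]
  by_contra! hlt
  have h1 : B a x ≥ -(‖B a‖ * ‖x‖) := (abs_le.1 ((B a).le_opNorm x)).1
  have h2 : B x p ≤ ‖B.flip p‖ * ‖x‖ := (abs_le.1 ((B.flip p).le_opNorm x)).2
  have h3 := hB x
  have hx' : B (x + a) (x - p) ≤ r := hx
  simp only [map_sub, map_add, add_apply] at hx'
  have h4 := le_abs_self (r + B a p)
  have hk0 : 0 ≤ k := by positivity
  have h5 : k + |r + B a p| + c < c * ‖x‖ := by
    rwa [hR, div_lt_iff₀ hc, mul_comm] at hlt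
  have h6 : 1 ≤ ‖x‖ := by
    by_contra! h
    nlinarith [abs_nonneg (r + B a p)]
  nlinarith [abs_nonneg (r + B a p)]

theorem IsMaximalMonotone.mem_of_forall {M : Set (F × StrongDual ℝ F)} (hM : IsMaximalMonotone M)
    {p : F × StrongDual ℝ F} (hp : ∀ q ∈ M, 0 ≤ (p.2 - q.2) (p.1 - q.1)) : p ∈ M := by
  have hmono : IsMonotone (insert p M) := by
    rintro a (rfl | ha) b (rfl | hb)
    · simp
    · exact hp b hb
    · have h := hp a ha
      rwa [← neg_sub b.1, ← neg_sub b.2, neg_apply, map_neg, neg_neg]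
    · exact hM.1 a ha b hb
  rw [hM.2 _ hmono (Set.subset_insert p M)]
  exact Set.mem_insert p M

theorem IsMaximalMonotone.nonempty {M : Set (F × StrongDual ℝ F)} (hM : IsMaximalMonotone M) :
    M.Nonempty := by
  by_contra h
  rw [Set.not_nonempty_iff_eq_empty] at h
  have : (0 : F × StrongDual ℝ F) ∈ M := hM.mem_of_forall (by simp [h])
  simp [h] at this

/-- Minty's surjectivity theorem in finite dimension. -/
theorem IsMaximalMonotone.exists_sub_form_mem [FiniteDimensional ℝ F]
    {M : Set (F × StrongDual ℝ F)} (hM : IsMaximalMonotone M) (B : F →L[ℝ] StrongDual ℝ F)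
    (hsymm : ∀ x y, B x y = B y x) {c : ℝ} (hc : 0 < c) (hB : ∀ x, c * ‖x‖ ^ 2 ≤ B x x)
    (w : StrongDual ℝ F) : ∃ x, (x, w - B x) ∈ M := by
  have hpos : ∀ x, 0 ≤ B x x := fun x => le_trans (by positivity) (hB x)
  have hinj : Function.Injective (B : F →ₗ[ℝ] StrongDual ℝ F) := by
    rw [← LinearMap.ker_eq_bot, LinearMap.ker_eq_bot']
    intro x hx
    have h := hB x
    have hx' : B x = 0 := hx
    rw [hx', zero_apply] at h
    by_contra hne
    have := norm_pos_iff.2 hne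
    exact absurd h (not_le.2 (by positivity))
  have hfin : Module.finrank ℝ F = Module.finrank ℝ (StrongDual ℝ F) := by
    rw [← (LinearMap.toContinuousLinearMap (𝕜 := ℝ) (E := F) (F' := ℝ)).finrank_eq,
      Module.finrank_linearMap, Module.finrank_self, mul_one]
  have hsurj : Function.Surjective (B : F →ₗ[ℝ] StrongDual ℝ F) :=
    (LinearMap.injective_iff_surjective_of_finrank_eq_finrank hfin).1 hinj
  choose g hg using hsurj
  have hg' : ∀ e, B (g e) = e := hg
  obtain ⟨p₀, hp₀⟩ := hM.nonempty
  -- By maximality `(x, w - B x) ∈ M` once `B (x + g (e - w)) (x - f) ≤ 0` for all `(f, e) ∈ M`, `g`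
  -- being inverse to `B`. Finite subfamilies are solvable only up to slack, so `ε` is part of the
  -- index and compactness removes it.
  let t : (M × {ε : ℝ // 0 < ε}) → Set F := fun i =>
    {x | B (x + g (i.1.1.2 - w)) (x - i.1.1.1) ≤ i.2.1}
  have hmono : ∀ i j : M × {ε : ℝ // 0 < ε},
      0 ≤ B (g (i.1.1.2 - w) - g (j.1.1.2 - w)) (i.1.1.1 - j.1.1.1) := fun i j => by
    rw [map_sub B, hg', hg', sub_sub_sub_cancel_right]
    exact hM.1 _ i.1.2 _ j.1.2
  have hcomp : ∀ i, IsCompact (t i) := fun i => isCompact_form_le B hc hB _ _ _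
  obtain ⟨x, -, hx⟩ := (hcomp (⟨p₀, hp₀⟩, ⟨1, one_pos⟩)).inter_iInter_nonempty t
    (fun i => (hcomp i).isClosed) fun u => by
      classical
      obtain ⟨x, hx⟩ := exists_forall_form_lt
        (ι := ↥(insert ((⟨p₀, hp₀⟩, ⟨1, one_pos⟩) : M × {ε : ℝ // 0 < ε}) u)) B hsymm hpos
        (fun i => g (i.1.1.1.2 - w)) (fun i => i.1.1.1.1) (fun i j => hmono i.1 j.1)
        (fun i => i.1.2.1) fun i => i.1.2.2
      refine ⟨x, (hx ⟨_, Finset.mem_insert_self _ u⟩).le, ?_⟩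
      simp only [Set.mem_iInter]
      exact fun i hi => (hx ⟨i, Finset.mem_insert_of_mem hi⟩).le
  refine ⟨x, hM.mem_of_forall fun q hq => ?_⟩
  have h : B (x + g (q.2 - w)) (x - q.1) ≤ 0 :=
    le_of_forall_pos_le_add fun ε hε => by
      rw [zero_add]
      exact Set.mem_iInter.1 hx (⟨q, hq⟩, ⟨ε, hε⟩)
  rw [map_add, hg'] at h
  have e : (w - B x - q.2) (x - q.1) = -((B x + (q.2 - w)) (x - q.1)) := by
    rw [← neg_apply]
    congr 1
    abel
  show 0 ≤ (w - B x - q.2) (x - q.1)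
  rw [e]
  linarith

/-- A monotone relation with the conclusion of Minty's theorem is maximal. -/
theorem IsMonotone.isMaximalMonotone_of_surjective {M : Set (F × StrongDual ℝ F)}
    (hM : IsMonotone M) (B : F →L[ℝ] StrongDual ℝ F) {c : ℝ} (hc : 0 < c)
    (hB : ∀ x, c * ‖x‖ ^ 2 ≤ B x x) (hsurj : ∀ w, ∃ x, (x, w - B x) ∈ M) :
    IsMaximalMonotone M := by
  refine ⟨hM, fun M' hM' hsub => hsub.antisymm fun p hp => ?_⟩
  -- With this `w`, monotonicity against `p` reads `0 ≤ -B (x - p.1) (x - p.1)`, so `x = p.1`.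
  obtain ⟨x, hx⟩ := hsurj (p.2 + B p.1)
  have h1 := hM' _ (hsub hx) _ hp
  have h2 := hB (x - p.1)
  have e : p.2 + B p.1 - B x - p.2 = -B (x - p.1) := by rw [map_sub]; abel
  simp only [e, neg_apply] at h1
  have h3 : x = p.1 := by
    rw [← sub_eq_zero]
    by_contra hne
    have := norm_pos_iff.2 hne
    have : 0 < c * ‖x - p.1‖ ^ 2 := by positivity
    linarith
  subst h3
  simpa using hx

theorem IsMaximalMonotone.isClosed {M : Set (F × StrongDual ℝ F)} (hM : IsMaximalMonotone M) :
    IsClosed M := by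
  have : M = ⋂ q ∈ M, {p : F × StrongDual ℝ F | 0 ≤ (p.2 - q.2) (p.1 - q.1)} := by
    ext p
    simp only [Set.mem_iInter, Set.mem_ofPred_eq]
    exact ⟨fun hp q hq => hM.1 p hp q hq, hM.mem_of_forall⟩
  rw [this]
  exact isClosed_biInter fun q _ => isClosed_le continuous_const
    ((continuous_snd.sub continuous_const).clm_apply (continuous_fst.sub continuous_const))

end Minty

open Filter Topology

/-! ### Maximality of the steady-state relation by penalisation -/

section SteadyStateMaximal

variable {FS Y : Type*} [NormedAddCommGroup FS] [NormedSpace ℝ FS]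
  [NormedAddCommGroup Y] [NormedSpace ℝ Y]

theorem IsMonotone.steadyState {M : Set ((FS × Y) × StrongDual ℝ (FS × Y))} (hM : IsMonotone M) :
    IsMonotone (steadyState M) := by
  rintro ⟨y, u⟩ ⟨e, h⟩ ⟨y', u'⟩ ⟨e', h'⟩
  simpa using hM _ h _ h'

/-- If `0` lies in the relative interior of `closure S` and `v` in the linear hull of `S`, then the
functional `B v` is positive somewhere on `S` as soon as it is positive at `v`. -/
theorem exists_pos_of_zero_mem_rint {S : Set FS} (h0 : (0 : FS) ∈ rint S)
    {B : FS →L[ℝ] StrongDual ℝ FS} {v : FS} (hv : v ∈ Submodule.span ℝ S) (hBv : 0 < B v v) :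
    ∃ f ∈ S, 0 < B v f := by
  obtain ⟨y, hy, hy0⟩ := mem_intrinsicInterior.1 h0
  have hmem : ∀ w ∈ Submodule.span ℝ S, w ∈ affineSpan ℝ (closure S) := by
    intro w hw
    have hsub : Submodule.span ℝ S ≤ (affineSpan ℝ (closure S)).direction := by
      refine Submodule.span_le.2 fun f hf => ?_
      have := AffineSubspace.vsub_mem_direction
        (subset_affineSpan ℝ _ (subset_closure hf)) y.2
      simpa [hy0] using this
    have := AffineSubspace.vadd_mem_of_mem_direction (hsub hw) y.2
    simpa [hy0] using this
  let γ : ℝ → affineSpan ℝ (closure S) := fun t =>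
    ⟨t • v, hmem _ (Submodule.smul_mem _ t hv)⟩
  have hγ : Continuous γ := by fun_prop
  have hγ0 : γ 0 = y := by
    apply Subtype.ext
    simp [γ, hy0]
  have hev : ∀ᶠ t in 𝓝 (0 : ℝ),
      γ t ∈ interior ((↑) ⁻¹' closure S : Set (affineSpan ℝ (closure S))) :=
    hγ.continuousAt.eventually (by rw [hγ0]; exact isOpen_interior.mem_nhds hy)
  obtain ⟨t, ht, htpos⟩ := ((hev.filter_mono nhdsWithin_le_nhds).and
    (self_mem_nhdsWithin (s := Set.Ioi (0 : ℝ)))).exists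
  have htS : t • v ∈ closure S :=
    interior_subset (s := ((↑) ⁻¹' closure S : Set (affineSpan ℝ (closure S)))) ht
  have hopen : IsOpen {f | 0 < B v f} := isOpen_lt continuous_const (B v).continuous
  obtain ⟨f, hf, hfS⟩ := mem_closure_iff.1 htS _ hopen
    (by simpa using mul_pos htpos hBv)
  exact ⟨f, hfS, hf⟩

/-- A sequence in `B (span S)` that is bounded above at each point of `S` is bounded. -/
theorem exists_norm_le_of_zero_mem_rint [FiniteDimensional ℝ FS] {S : Set FS}
    (h0 : (0 : FS) ∈ rint S) {B : FS →L[ℝ] StrongDual ℝ FS} {c : ℝ} (hc : 0 < c)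
    (hB : ∀ x, c * ‖x‖ ^ 2 ≤ B x x) {v : ℕ → FS} (hv : ∀ n, v n ∈ Submodule.span ℝ S)
    (hbdd : ∀ f ∈ S, ∃ C, ∀ n, B (v n) f ≤ C) : ∃ R, ∀ n, ‖v n‖ ≤ R := by
  by_contra! hR
  -- If the norms were unbounded, normalised vectors would accumulate at a unit `g` in the span. The
  -- pointwise bounds, divided by the norms, give `B g f ≤ 0` on `S`, against
  -- `exists_pos_of_zero_mem_rint`.
  choose φ hφ using fun k : ℕ => hR (k + 1 : ℝ)
  have hpos : ∀ k, 0 < ‖v (φ k)‖ := fun k => lt_trans (by positivity) (hφ k)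
  have : ProperSpace FS := FiniteDimensional.proper ℝ FS
  obtain ⟨g, hg, ψ, hψ, hlim⟩ := (isCompact_sphere (0 : FS) 1).tendsto_subseq
    (x := fun k => ‖v (φ k)‖⁻¹ • v (φ k)) fun k => by
      rw [mem_sphere_zero_iff_norm, norm_smul, norm_inv, norm_norm,
        inv_mul_cancel₀ (hpos k).ne']
  have hgV : g ∈ Submodule.span ℝ S :=
    (Submodule.closed_of_finiteDimensional (Submodule.span ℝ S)).mem_of_tendsto hlim
      (Eventually.of_forall fun k => Submodule.smul_mem _ _ (hv _))
  have hg1 : ‖g‖ = 1 := mem_sphere_zero_iff_norm.1 hg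
  have hgpos : 0 < B g g := by
    have := hB g
    rw [hg1] at this
    linarith
  obtain ⟨f, hfS, hf⟩ := exists_pos_of_zero_mem_rint h0 hgV hgpos
  obtain ⟨C, hC⟩ := hbdd f hfS
  have h1 : Tendsto (fun k => B (‖v (φ (ψ k))‖⁻¹ • v (φ (ψ k))) f) atTop (𝓝 (B g f)) :=
    ((B.flip f).continuous.tendsto g).comp hlim
  have h2 : Tendsto (fun k => ‖v (φ (ψ k))‖⁻¹ * C) atTop (𝓝 (0 * C)) := by
    refine Tendsto.mul_const C (Tendsto.inv_tendsto_atTop ?_)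
    have h3 : Tendsto (fun k => ((ψ k : ℕ) : ℝ)) atTop atTop :=
      tendsto_natCast_atTop_atTop.comp hψ.tendsto_atTop
    exact tendsto_atTop_mono (fun k => by linarith [hφ (ψ k)]) h3
  have h4 := le_of_tendsto_of_tendsto' h1 h2 fun k => by
    simpa using mul_le_mul_of_nonneg_left (hC (φ (ψ k))) (inv_nonneg.2 (norm_nonneg _))
  linarith

/-- The point of the estimate is that `C` does not depend on `r`. The penalty, at least `c * ‖f'‖ ^
2` because `1 ≤ r`, absorbs `e f'`, and half of the form in `y'` absorbs the terms linear in `y'`.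
-/
theorem penalized_bound {A : FS →L[ℝ] StrongDual ℝ FS} {B : Y →L[ℝ] StrongDual ℝ Y} {c d : ℝ}
    (hc : 0 < c) (hd : 0 < d) (hA : ∀ x, c * ‖x‖ ^ 2 ≤ A x x) (hB : ∀ x, d * ‖x‖ ^ 2 ≤ B x x)
    (w : StrongDual ℝ Y) (f : FS) (y : Y) (e : StrongDual ℝ FS) (u : StrongDual ℝ Y) :
    ∃ C, ∀ (r : ℝ) (f' : FS) (y' : Y), 1 ≤ r →
      0 ≤ (-A (r • f') - e) (f' - f) + (w - B y' - u) (y' - y) →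
      d / 2 * ‖y'‖ ^ 2 ≤ A (r • f') f + C := by
  set k := ‖w - u‖ + ‖B.flip y‖ with hk
  refine ⟨‖e‖ ^ 2 / (4 * c) + k ^ 2 / (2 * d) + e f - (w - u) y, fun r f' y' hr h => ?_⟩
  have h1 : -(e f') ≤ ‖e‖ * ‖f'‖ := by
    have := (abs_le.1 (e.le_opNorm f')).1
    linarith
  have h2 : (w - u) y' ≤ ‖w - u‖ * ‖y'‖ := (abs_le.1 ((w - u).le_opNorm y')).2
  have h3 : B y' y ≤ ‖B.flip y‖ * ‖y'‖ := (abs_le.1 ((B.flip y).le_opNorm y')).2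
  have h4 : c * ‖f'‖ ^ 2 ≤ r * A f' f' := by
    have := hA f'
    have h0 : 0 ≤ c * ‖f'‖ ^ 2 := by positivity
    nlinarith
  have h5 := hB y'
  have h6 : ‖e‖ * ‖f'‖ ≤ c * ‖f'‖ ^ 2 + ‖e‖ ^ 2 / (4 * c) := by
    have : c * ‖f'‖ ^ 2 + ‖e‖ ^ 2 / (4 * c) - ‖e‖ * ‖f'‖ =
        (2 * c * ‖f'‖ - ‖e‖) ^ 2 / (4 * c) := by
      field_simp
      ring
    have h0 : 0 ≤ (2 * c * ‖f'‖ - ‖e‖) ^ 2 / (4 * c) := by positivity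
    linarith
  have h7 : k * ‖y'‖ ≤ d / 2 * ‖y'‖ ^ 2 + k ^ 2 / (2 * d) := by
    have : d / 2 * ‖y'‖ ^ 2 + k ^ 2 / (2 * d) - k * ‖y'‖ = (d * ‖y'‖ - k) ^ 2 / (2 * d) := by
      field_simp
      ring
    have h0 : 0 ≤ (d * ‖y'‖ - k) ^ 2 / (2 * d) := by positivity
    linarith
  rw [hk, add_mul, ← hk] at h7
  simp only [map_sub, map_smul, sub_apply, neg_apply, smul_apply, smul_eq_mul] at h h1 h2 h3 ⊢
  linarith

theorem tendsto_coprod {α : Type*} {l : Filter α} {e : α → StrongDual ℝ FS}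
    {u : α → StrongDual ℝ Y} {e₀ : StrongDual ℝ FS} {u₀ : StrongDual ℝ Y}
    (he : Tendsto e l (𝓝 e₀)) (hu : Tendsto u l (𝓝 u₀)) :
    Tendsto (fun k => (e k).coprod (u k)) l (𝓝 (e₀.coprod u₀)) := by
  suffices h : Continuous fun p : StrongDual ℝ FS × StrongDual ℝ Y => p.1.coprod p.2 from
    (h.tendsto (e₀, u₀)).comp (he.prodMk_nhds hu)
  have : (fun p : StrongDual ℝ FS × StrongDual ℝ Y => p.1.coprod p.2) = fun p =>
      p.1.comp (ContinuousLinearMap.fst ℝ FS Y) + p.2.comp (ContinuousLinearMap.snd ℝ FS Y) := by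
    ext p z <;> simp
  rw [this]
  fun_prop

variable [FiniteDimensional ℝ FS] [FiniteDimensional ℝ Y]

/-- Solutions of the penalised problem, in which `fS = 0` is replaced by `eS = -n fS`. -/
theorem IsMaximalMonotone.exists_penalized {M : Set ((FS × Y) × StrongDual ℝ (FS × Y))}
    (hM : IsMaximalMonotone M) {A : FS →L[ℝ] StrongDual ℝ FS} (hAs : ∀ x y, A x y = A y x)
    {B : Y →L[ℝ] StrongDual ℝ Y} (hBs : ∀ x y, B x y = B y x) {c d : ℝ} (hc : 0 < c) (hd : 0 < d)
    (hA : ∀ x, c * ‖x‖ ^ 2 ≤ A x x) (hB : ∀ x, d * ‖x‖ ^ 2 ≤ B x x) (w : StrongDual ℝ Y)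
    {r : ℝ} (hr : 1 ≤ r) :
    ∃ f y, ((f, y), (-A (r • f)).coprod (w - B y)) ∈ M := by
  let Q : FS × Y →L[ℝ] StrongDual ℝ (FS × Y) :=
    r • A.bilinearComp (ContinuousLinearMap.fst ℝ FS Y) (ContinuousLinearMap.fst ℝ FS Y) +
      B.bilinearComp (ContinuousLinearMap.snd ℝ FS Y) (ContinuousLinearMap.snd ℝ FS Y)
  have hQ : ∀ z z', Q z z' = r * A z.1 z'.1 + B z.2 z'.2 := fun z z' => rfl
  obtain ⟨⟨f, y⟩, h⟩ := hM.exists_sub_form_mem Q (fun z z' => by rw [hQ, hQ, hAs, hBs])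
    (lt_min hc hd) (fun z => by
      rw [hQ]
      have h1 := hA z.1
      have h2 := hB z.2
      have h3 : 0 ≤ c * ‖z.1‖ ^ 2 := by positivity
      have h4 : 0 ≤ d * ‖z.2‖ ^ 2 := by positivity
      rcases max_cases ‖z.1‖ ‖z.2‖ with h | h
      · rw [Prod.norm_def, h.1]
        nlinarith [mul_le_mul_of_nonneg_right (min_le_left c d) (sq_nonneg ‖z.1‖)]
      · rw [Prod.norm_def, h.1]
        nlinarith [mul_le_mul_of_nonneg_right (min_le_right c d) (sq_nonneg ‖z.2‖)])
    (w.comp (ContinuousLinearMap.snd ℝ FS Y))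
  refine ⟨f, y, ?_⟩
  convert h using 2
  refine ContinuousLinearMap.ext fun z => ?_
  rw [sub_apply, hQ]
  simp
  ring

/-- The steady state relation satisfies the conclusion of Minty's theorem. -/
theorem IsMaximalMonotone.exists_sub_form_mem_steadyState
    {M : Set ((FS × Y) × StrongDual ℝ (FS × Y))} (hM : IsMaximalMonotone M)
    (h0 : (0 : FS) ∈ rint (stateFlows M)) {B : Y →L[ℝ] StrongDual ℝ Y}
    (hBs : ∀ x y, B x y = B y x) {d : ℝ} (hd : 0 < d) (hB : ∀ x, d * ‖x‖ ^ 2 ≤ B x x)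
    (w : StrongDual ℝ Y) : ∃ y, (y, w - B y) ∈ IncPH.steadyState M := by
  obtain ⟨A, hAs, c, hc, hA⟩ := exists_coercive_form FS
  choose f y hfy using fun n : ℕ => hM.exists_penalized hAs hBs hc hd hA hB w
    (r := (n : ℝ) + 1) (by simp)
  have hbound : ∀ g ∈ stateFlows M, ∃ C, ∀ n : ℕ,
      d / 2 * ‖y n‖ ^ 2 ≤ A (((n : ℝ) + 1) • f n) g + C := by
    rintro g ⟨e, x, u, hg⟩
    obtain ⟨C, hC⟩ := penalized_bound hc hd hA hB w g x e u
    refine ⟨C, fun n => ?_⟩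
    have h := hM.1 _ (hfy n) _ hg
    refine hC ((n : ℝ) + 1) (f n) (y n) (by simp) ?_
    simpa only [sub_apply, ContinuousLinearMap.coprod_apply, Prod.fst_sub, Prod.snd_sub,
      add_sub_add_comm] using h
  have hfS : ∀ n, f n ∈ stateFlows M := fun n => ⟨_, _, _, hfy n⟩
  obtain ⟨R, hR⟩ := exists_norm_le_of_zero_mem_rint h0 (B := A) hc hA
    (v := fun n : ℕ => -(((n : ℝ) + 1) • f n))
    (fun n => Submodule.neg_mem _ (Submodule.smul_mem _ _ (Submodule.subset_span (hfS n))))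
    fun g hg => by
      obtain ⟨C, hC⟩ := hbound g hg
      refine ⟨C, fun n => ?_⟩
      have h1 := hC n
      have h2 : 0 ≤ d / 2 * ‖y n‖ ^ 2 := by positivity
      rw [map_neg, neg_apply]
      linarith
  simp only [norm_neg] at hR
  obtain ⟨R', hR'⟩ : ∃ R', ∀ n, ‖y n‖ ≤ R' := by
    -- Any fixed state flow will do here, now that `(n + 1) • f n` is bounded.
    obtain ⟨C, hC⟩ := hbound _ (hfS 0)
    set T := ‖A.flip (f 0)‖ * R + C with hT
    refine ⟨2 * |T| / d + 1, fun n => ?_⟩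
    have h1 : A (((n : ℝ) + 1) • f n) (f 0) ≤ ‖A.flip (f 0)‖ * R :=
      ((abs_le.1 ((A.flip (f 0)).le_opNorm _)).2).trans
        (mul_le_mul_of_nonneg_left (hR n) (norm_nonneg _))
    have h2 : d / 2 * ‖y n‖ ^ 2 ≤ |T| := by
      have := hC n
      have := le_abs_self T
      linarith
    have h3 : ‖y n‖ ^ 2 ≤ 2 * |T| / d := by
      rw [le_div_iff₀ hd]
      linarith
    nlinarith [sq_nonneg (‖y n‖ - 1), norm_nonneg (y n)]
  have : ProperSpace FS := FiniteDimensional.proper ℝ FS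
  have : ProperSpace Y := FiniteDimensional.proper ℝ Y
  obtain ⟨⟨a, b⟩, -, φ, hφ, hlim⟩ :=
    ((isCompact_closedBall (0 : FS) R).prod (isCompact_closedBall (0 : Y) R')).tendsto_subseq
      (x := fun n : ℕ => (((n : ℝ) + 1) • f n, y n)) fun n =>
        ⟨mem_closedBall_zero_iff.2 (hR n), mem_closedBall_zero_iff.2 (hR' n)⟩
  rw [Prod.tendsto_iff] at hlim
  obtain ⟨hlima, hlimb⟩ := hlim
  have hf0 : Tendsto (fun k => f (φ k)) atTop (𝓝 0) := by
    have h := ((tendsto_one_div_add_atTop_nhds_zero_nat (𝕜 := ℝ)).comp hφ.tendsto_atTop).smul hlima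
    rw [zero_smul] at h
    have e : ∀ k, (1 / ((φ k : ℝ) + 1)) • ((φ k : ℝ) + 1) • f (φ k) = f (φ k) := fun k => by
      rw [smul_smul, one_div, inv_mul_cancel₀ (by positivity), one_smul]
    exact (tendsto_congr e).1 h
  have hlimA : Tendsto (fun k => -A (((φ k : ℝ) + 1) • f (φ k))) atTop (𝓝 (-A a)) :=
    ((A.continuous.tendsto a).comp hlima).neg
  have hlimB : Tendsto (fun k => B (y (φ k))) atTop (𝓝 (B b)) :=
    (B.continuous.tendsto b).comp hlimb
  have hcoprod : Tendsto
      (fun k => (-A (((φ k : ℝ) + 1) • f (φ k))).coprod (w - B (y (φ k)))) atTop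
      (𝓝 ((-A a).coprod (w - B b))) :=
    tendsto_coprod hlimA (tendsto_const_nhds.sub hlimB)
  exact ⟨b, -A a, hM.isClosed.mem_of_tendsto ((hf0.prodMk_nhds hlimb).prodMk_nhds hcoprod)
    (Eventually.of_forall fun k => hfy (φ k))⟩

theorem IsMaximalMonotone.steadyState {M : Set ((FS × Y) × StrongDual ℝ (FS × Y))}
    (hM : IsMaximalMonotone M) (h0 : (0 : FS) ∈ rint (stateFlows M)) :
    IsMaximalMonotone (IncPH.steadyState M) := by
  obtain ⟨B, hBs, d, hd, hB⟩ := exists_coercive_form Y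
  exact hM.1.steadyState.isMaximalMonotone_of_surjective B hd hB
    (hM.exists_sub_form_mem_steadyState h0 hBs hd hB)

end SteadyStateMaximal

/-! ### Rockafellar's potential of a cyclically monotone relation -/

section Rockafellar

variable {F : Type*} [NormedAddCommGroup F] [NormedSpace ℝ F]

theorem isMonotone_subdiffGraph {φ : StrongDual ℝ F → EReal} (hφ : ∀ e, φ e ≠ ⊥) :
    IsMonotone (subdiffGraph φ) := by
  rintro p ⟨hp, hp'⟩ q ⟨hq, hq'⟩
  have h1 := hp' q.2
  have h2 := hq' p.2
  lift φ p.2 to ℝ using ⟨hp.ne, hφ _⟩ with a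
  lift φ q.2 to ℝ using ⟨hq.ne, hφ _⟩ with b
  norm_cast at h1 h2
  simp only [sub_apply, map_sub] at h1 h2 ⊢
  linarith

/-- The value at `e` of the affine function of Rockafellar's construction that is given by the
chain `z 0, …, z m`. -/
def chainValue (m : ℕ) (z : ℕ → F × StrongDual ℝ F) (e : StrongDual ℝ F) : ℝ :=
  (e - (z 0).2) (z 0).1 + ∑ i ∈ Finset.range m, ((z i).2 - (z (i + 1)).2) (z (i + 1)).1

theorem chainValue_cons (m : ℕ) (z : ℕ → F × StrongDual ℝ F) (q : F × StrongDual ℝ F)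
    (e : StrongDual ℝ F) :
    chainValue (m + 1) (fun i => Nat.casesOn i q z) e = chainValue m z q.2 + (e - q.2) q.1 := by
  rw [chainValue, chainValue, Finset.sum_range_succ']
  show (e - q.2) q.1 + (∑ i ∈ Finset.range m, ((z i).2 - (z (i + 1)).2) (z (i + 1)).1 +
    (q.2 - (z 0).2) (z 0).1) = _
  ring

/-- Evaluating at the last effort closes the chain into a cycle; summation by parts turns the value
into minus the cyclic sum. The case `m = 0`, outside the definition, is trivial. -/
theorem IsCyclicallyMonotone.chainValue_nonpos {M : Set (F × StrongDual ℝ F)}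
    (hM : IsCyclicallyMonotone M) (m : ℕ) (z : ℕ → F × StrongDual ℝ F) (hz : ∀ i, z i ∈ M) :
    chainValue m z (z m).2 ≤ 0 := by
  rcases Nat.eq_zero_or_pos m with rfl | hm
  · simp [chainValue]
  have h := hM m hm (fun i => z i) fun i => hz i
  rw [Fin.sum_univ_castSucc] at h
  simp only [Fin.last_add_one, Fin.val_castSucc, Fin.coeSucc_eq_succ, Fin.val_succ, Fin.val_last,
    Fin.val_zero] at h
  rw [Fin.sum_univ_eq_sum_range (fun i => (z i).2 ((z i).1 - (z (i + 1)).1)) m] at h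
  have e : ∑ i ∈ Finset.range m, (z i).2 ((z i).1 - (z (i + 1)).1) +
      ∑ i ∈ Finset.range m, ((z i).2 - (z (i + 1)).2) (z (i + 1)).1 =
      (z 0).2 (z 0).1 - (z m).2 (z m).1 := by
    rw [← Finset.sum_add_distrib, ← Finset.sum_range_sub' (fun i => (z i).2 (z i).1) m]
    refine Finset.sum_congr rfl fun i _ => ?_
    simp only [map_sub, sub_apply]
    ring
  simp only [chainValue]
  simp only [map_sub, sub_apply] at h e ⊢
  linarith

/-- Rockafellar's potential of the relation `M`, normalised at `p₀`. -/
noncomputable def rockafellarFunction (M : Set (F × StrongDual ℝ F)) (p₀ : F × StrongDual ℝ F)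
    (e : StrongDual ℝ F) : EReal :=
  ⨆ s : {s : ℕ × (ℕ → F × StrongDual ℝ F) // (∀ i, s.2 i ∈ M) ∧ s.2 s.1 = p₀},
    (chainValue s.1.1 s.1.2 e : EReal)

theorem IsCyclicallyMonotone.rockafellarFunction_self_le {M : Set (F × StrongDual ℝ F)}
    (hM : IsCyclicallyMonotone M) (p₀ : F × StrongDual ℝ F) :
    rockafellarFunction M p₀ p₀.2 ≤ 0 := by
  refine iSup_le ?_
  rintro ⟨⟨m, z⟩, hz, rfl⟩
  exact_mod_cast hM.chainValue_nonpos m z hz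

theorem rockafellarFunction_ne_bot {M : Set (F × StrongDual ℝ F)} {p₀ : F × StrongDual ℝ F}
    (hp₀ : p₀ ∈ M) (e : StrongDual ℝ F) : rockafellarFunction M p₀ e ≠ ⊥ := by
  refine ne_bot_of_le_ne_bot (EReal.coe_ne_bot _)
    (le_iSup (fun s : {s : ℕ × (ℕ → F × StrongDual ℝ F) // (∀ i, s.2 i ∈ M) ∧ s.2 s.1 = p₀} =>
      (chainValue s.1.1 s.1.2 e : EReal)) ⟨(0, fun _ => p₀), fun _ => hp₀, rfl⟩)

theorem IsCyclicallyMonotone.isProperConvex_rockafellarFunction {M : Set (F × StrongDual ℝ F)}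
    (hM : IsCyclicallyMonotone M) {p₀ : F × StrongDual ℝ F} (hp₀ : p₀ ∈ M) :
    IsProperConvex (rockafellarFunction M p₀) := by
  refine ⟨rockafellarFunction_ne_bot hp₀,
    ⟨p₀.2, ((hM.rockafellarFunction_self_le p₀).trans_lt EReal.zero_lt_top).ne⟩, ?_⟩
  rintro ⟨e₁, t₁⟩ h₁ ⟨e₂, t₂⟩ h₂ a b ha hb hab
  simp only [Set.mem_ofPred_eq, rockafellarFunction, iSup_le_iff, EReal.coe_le_coe_iff, Prod.smul_mk,
    Prod.mk_add_mk, smul_eq_mul] at h₁ h₂ ⊢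
  intro s
  have k₁ := mul_le_mul_of_nonneg_left (h₁ s) ha
  have k₂ := mul_le_mul_of_nonneg_left (h₂ s) hb
  refine le_trans (le_of_eq ?_) (add_le_add k₁ k₂)
  obtain rfl : b = 1 - a := by linarith
  simp only [chainValue, sub_apply, add_apply,
    smul_apply, smul_eq_mul]
  ring

theorem lowerSemicontinuous_rockafellarFunction (M : Set (F × StrongDual ℝ F))
    (p₀ : F × StrongDual ℝ F) : LowerSemicontinuous (rockafellarFunction M p₀) := by
  refine lowerSemicontinuous_iSup fun s => Continuous.lowerSemicontinuous ?_
  refine continuous_coe_real_ereal.comp ?_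
  unfold chainValue
  exact ((continuous_id.sub continuous_const).clm_apply continuous_const).add continuous_const

theorem IsCyclicallyMonotone.subset_subdiffGraph {M : Set (F × StrongDual ℝ F)}
    (hM : IsCyclicallyMonotone M) (p₀ : F × StrongDual ℝ F) :
    M ⊆ subdiffGraph (rockafellarFunction M p₀) := by
  intro q hq
  have key : ∀ e', rockafellarFunction M p₀ q.2 + (((e' - q.2) q.1 : ℝ) : EReal) ≤
      rockafellarFunction M p₀ e' := by
    intro e'
    rw [← EReal.le_sub_iff_add_le (Or.inl (EReal.coe_ne_bot _)) (Or.inl (EReal.coe_ne_top _))]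
    refine iSup_le ?_
    rintro ⟨⟨m, z⟩, hz, hz'⟩
    rw [EReal.le_sub_iff_add_le (Or.inl (EReal.coe_ne_bot _)) (Or.inl (EReal.coe_ne_top _))]
    -- Putting `q` at the head of a chain ending at `p₀` gives another such chain, whose value at
    -- `e'` is the old value at `q.2` plus `(e' - q.2) q.1`.
    refine le_trans (le_of_eq ?_)
      (le_iSup (fun s : {s : ℕ × (ℕ → F × StrongDual ℝ F) // (∀ i, s.2 i ∈ M) ∧ s.2 s.1 = p₀} =>
        (chainValue s.1.1 s.1.2 e' : EReal))
        ⟨(m + 1, fun i => Nat.casesOn i q z), fun i => by cases i <;> simp [hq, hz], hz'⟩)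
    rw [chainValue_cons]
    norm_cast
  refine ⟨?_, key⟩
  -- Finiteness at `q.2` comes from the subgradient inequality tested at `p₀.2`, where the potential
  -- is at most `0`.
  have h := (key p₀.2).trans (hM.rockafellarFunction_self_le p₀)
  rw [lt_top_iff_ne_top]
  intro htop
  rw [htop, EReal.top_add_coe] at h
  exact absurd h (by simp)

theorem IsMaximalMonotone.exists_eq_subdiffGraph {M : Set (F × StrongDual ℝ F)}
    (hM : IsMaximalMonotone M) (hne : M.Nonempty) (hcyc : IsCyclicallyMonotone M) :
    ∃ K : StrongDual ℝ F → EReal,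
      IsProperConvex K ∧ LowerSemicontinuous K ∧ M = subdiffGraph K := by
  obtain ⟨p₀, hp₀⟩ := hne
  exact ⟨rockafellarFunction M p₀, hcyc.isProperConvex_rockafellarFunction hp₀,
    lowerSemicontinuous_rockafellarFunction M p₀,
    hM.2 _ (isMonotone_subdiffGraph (rockafellarFunction_ne_bot hp₀))
      (hcyc.subset_subdiffGraph p₀)⟩

end Rockafellar

/-! ### Partial minimisation over the state efforts -/

section SteadyStateFunction

variable {FS Y : Type*} [NormedAddCommGroup FS] [NormedSpace ℝ FS]
  [NormedAddCommGroup Y] [NormedSpace ℝ Y]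

theorem steadyStateFunction_le (K : StrongDual ℝ (FS × Y) → EReal) (eS : StrongDual ℝ FS)
    (u : StrongDual ℝ Y) : steadyStateFunction K u ≤ K (eS.coprod u) := by
  rw [steadyStateFunction, EReal.neg_le]
  refine le_trans (le_of_eq ?_) (le_iSup _ eS)
  simp

theorem le_steadyStateFunction {K : StrongDual ℝ (FS × Y) → EReal} {u : StrongDual ℝ Y}
    {t : EReal} (h : ∀ eS : StrongDual ℝ FS, t ≤ K (eS.coprod u)) :
    t ≤ steadyStateFunction K u := by
  rw [steadyStateFunction, EReal.le_neg]
  refine iSup_le fun eS => ?_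
  simpa using h eS

theorem exists_lt_of_steadyStateFunction_lt {K : StrongDual ℝ (FS × Y) → EReal}
    {u : StrongDual ℝ Y} {t : EReal} (h : steadyStateFunction K u < t) :
    ∃ eS : StrongDual ℝ FS, K (eS.coprod u) < t := by
  by_contra! hne
  exact absurd (le_steadyStateFunction hne) (not_le.2 h)

theorem convex_epigraph_steadyStateFunction {K : StrongDual ℝ (FS × Y) → EReal}
    (hK : Convex ℝ {p : StrongDual ℝ (FS × Y) × ℝ | K p.1 ≤ (p.2 : EReal)}) :
    Convex ℝ {p : StrongDual ℝ Y × ℝ | steadyStateFunction K p.1 ≤ (p.2 : EReal)} := by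
  rintro ⟨u₁, t₁⟩ h₁ ⟨u₂, t₂⟩ h₂ a b ha hb hab
  simp only [Set.mem_ofPred_eq, Prod.smul_mk, Prod.mk_add_mk, smul_eq_mul] at h₁ h₂ ⊢
  -- The infimum over `eS` need not be attained, so near-minimisers with slack `ε` are combined.
  refine EReal.le_of_forall_lt_iff_le.1 fun t ht => ?_
  have ht' : a * t₁ + b * t₂ < t := by exact_mod_cast ht
  set ε := t - (a * t₁ + b * t₂)
  have hε : 0 < ε := sub_pos.2 ht'
  obtain ⟨e₁, he₁⟩ := exists_lt_of_steadyStateFunction_lt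
    (h₁.trans_lt (EReal.coe_lt_coe (lt_add_of_pos_right t₁ hε)))
  obtain ⟨e₂, he₂⟩ := exists_lt_of_steadyStateFunction_lt
    (h₂.trans_lt (EReal.coe_lt_coe (lt_add_of_pos_right t₂ hε)))
  have h := hK (x := (e₁.coprod u₁, t₁ + ε)) he₁.le (y := (e₂.coprod u₂, t₂ + ε)) he₂.le ha hb hab
  simp only [Set.mem_ofPred_eq, Prod.smul_mk, Prod.mk_add_mk, smul_eq_mul] at h
  have e : a • e₁.coprod u₁ + b • e₂.coprod u₂ = (a • e₁ + b • e₂).coprod (a • u₁ + b • u₂) := by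
    ext <;> simp
  have e' : a * (t₁ + ε) + b * (t₂ + ε) = t := by
    have : a * (t₁ + ε) + b * (t₂ + ε) = a * t₁ + b * t₂ + (a + b) * ε := by ring
    rw [this, hab]
    simp [ε]
  rw [e, e'] at h
  exact (steadyStateFunction_le K _ _).trans h

/-- The functional `eS.coprod u` takes the value `u y` at `(0, y)`, whatever `eS` is, so the
right-hand side of the subgradient inequality may be minimised over `eS'`. -/
theorem steadyState_subset_subdiffGraph {K : StrongDual ℝ (FS × Y) → EReal} :
    steadyState (subdiffGraph K) ⊆ subdiffGraph (steadyStateFunction K) := by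
  rintro ⟨y, u⟩ ⟨eS, hlt, hle⟩
  refine ⟨(steadyStateFunction_le K eS u).trans_lt hlt, fun u' => ?_⟩
  refine le_steadyStateFunction fun eS' => ?_
  refine le_trans (add_le_add_left (steadyStateFunction_le K eS u) _) ?_
  refine le_trans (le_of_eq ?_) (hle (eS'.coprod u'))
  simp

theorem isProperConvex_steadyStateFunction {K : StrongDual ℝ (FS × Y) → EReal}
    (hK : IsProperConvex K) (hne : (steadyState (subdiffGraph K)).Nonempty) :
    IsProperConvex (steadyStateFunction K) := by
  obtain ⟨⟨y, u⟩, eS, hlt, hle⟩ := hne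
  refine ⟨fun u' => ?_, ⟨u, ((steadyStateFunction_le K eS u).trans_lt hlt).ne⟩,
    convex_epigraph_steadyStateFunction hK.2.2⟩
  have hb := hK.1 (eS.coprod u)
  simp only at hlt hle
  lift K (eS.coprod u) to ℝ using ⟨hlt.ne, hb⟩ with r
  -- One steady state supplies a finite affine minorant, which excludes the value `⊥`.
  have h : ((r + (u' - u) y : ℝ) : EReal) ≤ steadyStateFunction K u' :=
    le_steadyStateFunction fun eS' => by
      refine le_trans (le_of_eq ?_) (hle (eS'.coprod u'))
      simp
  exact ne_bot_of_le_ne_bot (EReal.coe_ne_bot _) h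

end SteadyStateFunction

end IncPH

theorem mainTheorem6 {FS Y : Type*}
    [NormedAddCommGroup FS] [NormedSpace ℝ FS] [FiniteDimensional ℝ FS]
    [NormedAddCommGroup Y] [NormedSpace ℝ Y] [FiniteDimensional ℝ Y]
    (M : Set ((FS × Y) × StrongDual ℝ (FS × Y)))
    (hM : IncPH.IsMaximalMonotone M)
    (h_flow : (0 : FS) ∈ IncPH.rint (IncPH.stateFlows M))
    (h_effort : ∃ e : StrongDual ℝ FS, e ∈ IncPH.rint (IncPH.zeroFlowEfforts M)) :
    IncPH.IsMaximalMonotone (IncPH.steadyState M) ∧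
    (IncPH.IsCyclicallyMonotone M →
      (∃ K : StrongDual ℝ (FS × Y) → EReal,
        IncPH.IsProperConvex K ∧ LowerSemicontinuous K ∧ M = IncPH.subdiffGraph K) ∧
      ∀ K : StrongDual ℝ (FS × Y) → EReal,
        IncPH.IsProperConvex K → M = IncPH.subdiffGraph K →
          IncPH.IsProperConvex (IncPH.steadyStateFunction K) ∧
          IncPH.steadyState M = IncPH.subdiffGraph (IncPH.steadyStateFunction K)) := by
  have hS := hM.steadyState h_flow
  refine ⟨hS, fun hcyc => ⟨hM.exists_eq_subdiffGraph hM.nonempty hcyc, fun K hK hMK => ?_⟩⟩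
  have hne := hS.nonempty
  rw [hMK] at hS hne ⊢
  have hKs := IncPH.isProperConvex_steadyStateFunction hK hne
  exact ⟨hKs, hS.2 _ (IncPH.isMonotone_subdiffGraph hKs.1) IncPH.steadyState_subset_subdiffGraph⟩
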